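/- Let $X$ be a Banach space that is nearly uniformly convex (NUC), i.e. $X$ is reflexive and its norm is uniformly Kadec–Klee: for every $\epsilon>0$ there is $\delta>0$ such that $\|x_0\|\le 1-\delta$ whenever $(x_n)$ is a sequence in the closed unit ball converging weakly to $x_0$ with $\inf\{\|x_n-x_m\| : n\ne m\}>\epsilon$. Let $A,B\subseteq X$ be nonempty, bounded, closed and convex, and put $\operatorname{dist}(A,B)=\inf\{\|a-b\| : a\in A,\ b\in B\}$. Assume: 1. $(A,B)$ is a proximal parallel pair: for each $(x,y)\in A\times B$ there is exactly one $(x_1,y_1)\in A\times B$ with $\|x-y_1\|=\operatorname{dist}(A,B)=\|y-x_1\|$, and there is a unique $h\in X$ with $B=A+h$; 2. $(A,B)$ has the rectangle property: $\|x+h-y\|=\|y+h-x\|$ for all $x,y\in A$, with $h$ as in 1; 3. $(A,B)$ has the property $UC$: if $(x_n),(z_n)$ are sequences in $A$ and $(y_n)$ is a sequence in $B$ with $\lim_n\|x_n-y_n\|=\lim_n\|z_n-y_n\|=\operatorname{dist}(A,B)$, then $\lim_n\|x_n-z_n\|=0$. Let $T:A\cup B\to A\cup B$ be continuous with $T(A)\subseteq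 A$ and $T(B)\subseteq B$, and asymptotically relatively nonexpansive: there is a sequence $(k_n)$ in $[1,\infty)$ with $\lim_n k_n=1$ such that $\|T^nx-T^ny\|\le k_n\|x-y\|$ for all $n$, all $x\in A$ and all $y\in B$. Then there exist $x\in A$ and $y\in B$ such that $Tx=x$, $Ty=y$ and $\|x-y\|=\operatorname{dist}(A,B)$. -/

import Mathlib

open Set Filter Topology

noncomputable section

namespace BestProximity

variable {X : Type*} [NormedAddCommGroup X] [NormedSpace ℝ X]

/-- The distance `dist(A, B) = inf {‖a - b‖ : a ∈ A, b ∈ B}` between two sets. -/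
def setDist (A B : Set X) : ℝ :=
  sInf (image2 (fun a b => ‖a - b‖) A B)

/-- The separation constant `sep {x_n} = inf {‖x_n - x_m‖ : n ≠ m}` of a sequence. -/
def sep (x : ℕ → X) : ℝ :=
  sInf {r : ℝ | ∃ n m : ℕ, n ≠ m ∧ r = ‖x n - x m‖}

/-- Weak convergence of the sequence `x` to `x₀`, i.e. convergence in the weak topology of `X`. -/
def WeaklyConvergesTo (x : ℕ → X) (x₀ : X) : Prop :=
  Tendsto (fun n => toWeakSpace ℝ X (x n)) atTop (𝓝 (toWeakSpace ℝ X x₀))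

variable (X) in
/-- Reflexivity: the canonical embedding of `X` into its double dual is onto. -/
def IsReflexiveSpace : Prop :=
  Function.Surjective (NormedSpace.inclusionInDoubleDual ℝ X)

variable (X) in
/-- The norm of `X` is uniformly Kadec-Klee (UKK). -/
def HasUKKNorm : Prop :=
  ∀ ε : ℝ, 0 < ε → ∃ δ : ℝ, 0 < δ ∧
    ∀ (x : ℕ → X) (x₀ : X), (∀ n, ‖x n‖ ≤ 1) → WeaklyConvergesTo x x₀ → ε < sep x →
      ‖x₀‖ ≤ 1 - δ

variable (X) in
/-- Nearly uniformly convex (NUC) spaces: reflexive with a uniformly Kadec-Klee norm. -/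
def IsNUC : Prop :=
  IsReflexiveSpace X ∧ HasUKKNorm X

/-- `(x₁, y₁) ∈ A × B` is a proximal partner of `(x, y)`:
`‖x - y₁‖ = dist(A, B) = ‖y - x₁‖`. -/
def IsProximalPartner (A B : Set X) (p q : X × X) : Prop :=
  q ∈ A ×ˢ B ∧ ‖p.1 - q.2‖ = setDist A B ∧ ‖p.2 - q.1‖ = setDist A B

/-- Proximal pairs. -/
def IsProximalPair (A B : Set X) : Prop :=
  ∀ p ∈ A ×ˢ B, ∃ q, IsProximalPartner A B p q

/-- Sharp proximal pairs: the partner of each element of `A × B` exists and is unique. -/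
def IsSharpProximalPair (A B : Set X) : Prop :=
  ∀ p ∈ A ×ˢ B, ∃! q, IsProximalPartner A B p q

/-- Proximal parallel pairs: sharp proximal pairs with `B = A + h` for a unique `h`. -/
def IsProximalParallelPair (A B : Set X) : Prop :=
  IsSharpProximalPair A B ∧ ∃! h : X, B = (fun a => a + h) '' A

/-- The rectangle property: `‖x + h - y‖ = ‖y + h - x‖` for all `x, y ∈ A`, where `B = A + h`
(for proximal parallel pairs, such an `h` exists and is unique). -/
def HasRectangleProperty (A B : Set X) : Prop :=
  ∃ h : X, B = (fun a => a + h) '' A ∧ ∀ x ∈ A, ∀ y ∈ A, ‖x + h - y‖ = ‖y + h - x‖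

/-- The property UC of a pair of sets. -/
def HasPropertyUC (A B : Set X) : Prop :=
  ∀ x z y : ℕ → X, (∀ n, x n ∈ A) → (∀ n, z n ∈ A) → (∀ n, y n ∈ B) →
    Tendsto (fun n => ‖x n - y n‖) atTop (𝓝 (setDist A B)) →
    Tendsto (fun n => ‖z n - y n‖) atTop (𝓝 (setDist A B)) →
    Tendsto (fun n => ‖x n - z n‖) atTop (𝓝 0)

/-- Asymptotically relatively nonexpansive maps on `A ∪ B`; only the values of `T` on `A ∪ B`
matter when `T` maps `A ∪ B` into itself. -/
def IsAsympRelNonexpansive (A B : Set X) (T : X → X) : Prop :=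
  ∃ k : ℕ → ℝ, (∀ n, 1 ≤ k n) ∧ Tendsto k atTop (𝓝 1) ∧
    ∀ n, ∀ x ∈ A, ∀ y ∈ B, ‖T^[n] x - T^[n] y‖ ≤ k n * ‖x - y‖

end BestProximity

end

/-! Put `d x y = ‖x + h - y‖` on `A`, where `B = A + h`. By the rectangle property `d` is symmetric
and at least `‖h‖ = dist(A, B)`; by UC, `d x y` near `‖h‖` forces `x` near `y`. For every ε > 0,
large iterates of `T` raise `d` by at most ε, uniformly on `A`.

Take a minimal closed convex `K` containing the weak limits of its orbits, and `x ∈ K`. Minimality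
makes `limsup d (T^[n] x) y` a constant `r` for `y ∈ K` (`exists_asympSublevel_eq`). Suppose `r >
‖h‖`. A separated orbit subsequence would, by UKK, have a weak limit in `K` of asymptotic distance
below `r`, so the orbit is precompact (`totallyBounded_range_iterate`). But averaging a finite net
of its limit points also gets below `r` (`not_totallyBounded_range_iterate`). Hence `r = ‖h‖`, and
UC at `y = x` gives `T^[n] x → x`, so `T x = x` by continuity. UC also brings the orbit of `x + h`
back to `x + h`. -/

namespace BestProximity

/-! ### Weak compactness and the scaled Kadec–Klee property. -/

section WeakTopology

variable {X : Type*} [NormedAddCommGroup X] [NormedSpace ℝ X]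

theorem weaklyConvergesTo_of_tendsto {x : ℕ → X} {x₀ : X} (h : Tendsto x atTop (𝓝 x₀)) :
    WeaklyConvergesTo x x₀ :=
  ((toWeakSpaceCLM ℝ X).continuous.tendsto x₀).comp h

theorem WeaklyConvergesTo.sub_const {x : ℕ → X} {x₀ : X} (h : WeaklyConvergesTo x x₀) (a : X) :
    WeaklyConvergesTo (fun n => x n - a) (x₀ - a) := by
  simp only [WeaklyConvergesTo, map_sub] at h ⊢
  exact h.sub tendsto_const_nhds

theorem WeaklyConvergesTo.const_smul {x : ℕ → X} {x₀ : X} (h : WeaklyConvergesTo x x₀) (c : ℝ) :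
    WeaklyConvergesTo (fun n => c • x n) (c • x₀) := by
  simp only [WeaklyConvergesTo, map_smul] at h ⊢
  exact Filter.Tendsto.const_smul h c

theorem WeaklyConvergesTo.comp {x : ℕ → X} {x₀ : X} (h : WeaklyConvergesTo x x₀) {φ : ℕ → ℕ}
    (hφ : Tendsto φ atTop atTop) : WeaklyConvergesTo (fun n => x (φ n)) x₀ :=
  Tendsto.comp (f := φ) h hφ

theorem isClosed_toWeakSpace_image {S : Set X} (hS : IsClosed S) (hconv : Convex ℝ S) :
    IsClosed (toWeakSpace ℝ X '' S) := by
  have h := hconv.toWeakSpace_closure ℝ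
  rw [hS.closure_eq] at h
  rw [h]
  exact isClosed_closure

theorem WeaklyConvergesTo.mem_of_eventually {x : ℕ → X} {x₀ : X} (h : WeaklyConvergesTo x x₀)
    {S : Set X} (hS : IsClosed S) (hconv : Convex ℝ S) (hx : ∀ᶠ n in atTop, x n ∈ S) :
    x₀ ∈ S := by
  have := (isClosed_toWeakSpace_image hS hconv).mem_of_tendsto h
    (hx.mono fun n hn => mem_image_of_mem _ hn)
  exact ((toWeakSpace ℝ X).injective.mem_set_image).1 this

theorem IsReflexiveSpace.isCompact_toWeakSpace_image (hX : IsReflexiveSpace X) {S : Set X}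
    (hS : IsClosed S) (hconv : Convex ℝ S) (hb : Bornology.IsBounded S) :
    IsCompact (toWeakSpace ℝ X '' S) := by
  rw [← (isClosed_toWeakSpace_image hS hconv).closure_eq]
  refine NormedSpace.isCompact_closure_of_isBounded ℝ X _ ?_ ?_
  · rwa [preimage_image_eq _ (toWeakSpace ℝ X).injective]
  · intro φ _
    obtain ⟨x, hx⟩ := hX (WeakDual.toStrongDual φ)
    exact ⟨toWeakSpace ℝ X x, congrArg StrongDual.toWeakDual hx⟩

/-- A separable subspace has a countable family of functionals separating its points. -/
theorem exists_seq_separating_dual {M : Submodule ℝ X}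
    (hM : TopologicalSpace.IsSeparable (M : Set X)) :
    ∃ g : ℕ → StrongDual ℝ X, ∀ u ∈ M, (∀ n, g n u = 0) → u = 0 := by
  obtain ⟨t, _, htc, ht⟩ := hM.exists_countable_dense_subset
  have htne : t.Nonempty := closure_nonempty_iff.1 ⟨0, ht M.zero_mem⟩
  obtain ⟨s, rfl⟩ := htc.exists_eq_range htne
  choose g hg hgs using fun n => exists_dual_vector'' ℝ (s n)
  refine ⟨g, fun u hu h0 => ?_⟩
  by_contra hne
  have hpos : 0 < ‖u‖ := norm_pos_iff.2 hne
  obtain ⟨_, ⟨n, rfl⟩, hn⟩ := Metric.mem_closure_iff.1 (ht hu) (‖u‖ / 2) (by positivity)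
  rw [dist_eq_norm] at hn
  -- `g n` norms `s n` and kills `u`, so `‖s n‖` is at most `‖u - s n‖ < ‖u‖ / 2`, too small for a
  -- point that close to `u`.
  have h1 : ‖s n‖ ≤ ‖u - s n‖ := by
    have h2 := (g n).le_of_opNorm_le (hg n) (u - s n)
    rwa [map_sub, h0, hgs, zero_sub, norm_neg, one_mul, RCLike.norm_ofReal, abs_norm] at h2
  have := norm_le_norm_add_norm_sub' u (s n)
  linarith

/-- Closed bounded convex subsets of a reflexive space are weakly sequentially compact. -/
theorem IsReflexiveSpace.exists_subseq_weaklyConvergesTo (hX : IsReflexiveSpace X) {S : Set X}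
    (hS : IsClosed S) (hconv : Convex ℝ S) (hb : Bornology.IsBounded S) {x : ℕ → X}
    (hx : ∀ n, x n ∈ S) :
    ∃ z ∈ S, ∃ φ : ℕ → ℕ, StrictMono φ ∧ WeaklyConvergesTo (fun n => x (φ n)) z := by
  set M : Submodule ℝ X := (Submodule.span ℝ (range x)).topologicalClosure
  have hMsep : TopologicalSpace.IsSeparable (M : Set X) :=
    ((countable_range x).isSeparable.span (R := ℝ)).closure
  have hxM : ∀ n, x n ∈ M := fun n =>
    Submodule.le_topologicalClosure _ (Submodule.subset_span (mem_range_self n))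
  obtain ⟨g, hg⟩ := exists_seq_separating_dual hMsep
  set C := toWeakSpace ℝ X '' (S ∩ M)
  have hC : IsCompact C := hX.isCompact_toWeakSpace_image
    (hS.inter (Submodule.isClosed_topologicalClosure _)) (hconv.inter M.convex)
    (hb.subset inter_subset_left)
  have : CompactSpace C := isCompact_iff_compactSpace.1 hC
  -- Countably many functionals separate the points of the weakly compact `C`, so `C` is metrizable
  -- and compactness becomes sequential.
  have : TopologicalSpace.MetrizableSpace C := by
    refine Metric.PiNatEmbed.TopologicalSpace.MetrizableSpace.of_countable_separating
      (fun n (c : C) => g n ((toWeakSpace ℝ X).symm c)) (fun n => ?_) ?_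
    · exact (WeakBilin.eval_continuous (topDualPairing ℝ X).flip (g n)).comp
        continuous_subtype_val
    · rintro ⟨_, u, hu, rfl⟩ ⟨_, v, hv, rfl⟩ hne
      by_contra! hall
      have huv : u - v = 0 := hg _ (M.sub_mem hu.2 hv.2) fun n => by
        rw [map_sub, sub_eq_zero]
        simpa using hall n
      exact hne (Subtype.ext (congrArg (toWeakSpace ℝ X) (sub_eq_zero.1 huv)))
  let _ := TopologicalSpace.metrizableSpaceMetric C
  obtain ⟨⟨_, z, hz, rfl⟩, -, φ, hφ, hlim⟩ := (isCompact_univ (X := C)).tendsto_subseq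
    (x := fun n => ⟨toWeakSpace ℝ X (x n), mem_image_of_mem _ ⟨hx n, hxM n⟩⟩)
    (fun n => mem_univ _)
  exact ⟨z, hz.1, φ, hφ, (continuous_subtype_val.tendsto _).comp hlim⟩

/-- The uniform Kadec-Klee property for balls of radius at most `R₀`. -/
theorem HasUKKNorm.exists_norm_le_mul (hX : HasUKKNorm X) {σ R₀ : ℝ} (hσ : 0 < σ) (hR₀ : 0 < R₀) :
    ∃ δ : ℝ, 0 < δ ∧ ∀ (R : ℝ) (x : ℕ → X) (x₀ : X), 0 < R → R ≤ R₀ → (∀ n, ‖x n‖ ≤ R) →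
      WeaklyConvergesTo x x₀ → (∀ n m, n ≠ m → σ ≤ ‖x n - x m‖) → ‖x₀‖ ≤ R * (1 - δ) := by
  -- Rescaling by `R⁻¹` leaves separation at least `σ / R₀`; the factor 2 gives the strict
  -- inequality in UKK.
  obtain ⟨δ, hδ, h⟩ := hX (σ / (2 * R₀)) (by positivity)
  refine ⟨δ, hδ, fun R x x₀ hR hRR hx hw hsep => ?_⟩
  have key := h (fun n => R⁻¹ • x n) (R⁻¹ • x₀) (fun n => ?_) (hw.const_smul _) ?_
  · rw [norm_smul, norm_inv, Real.norm_of_nonneg hR.le, inv_mul_le_iff₀ hR] at key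
    exact key
  · rw [norm_smul, norm_inv, Real.norm_of_nonneg hR.le, inv_mul_le_iff₀ hR, mul_one]
    exact hx n
  · have h1 : σ / (2 * R₀) < σ / R₀ := by
      apply div_lt_div_of_pos_left hσ hR₀
      linarith
    refine h1.trans_le (le_csInf ⟨_, 0, 1, by simp, rfl⟩ ?_)
    rintro _ ⟨n, m, hnm, rfl⟩
    rw [← smul_sub, norm_smul, norm_inv, Real.norm_of_nonneg hR.le, inv_mul_eq_div]
    exact div_le_div₀ (norm_nonneg _) (hsep n m hnm) hR hRR

end WeakTopology

end BestProximity

namespace BestProximity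

/-! ### Minimal sets, asymptotic distance and the fixed point in `A`. -/

section FixedPoint

variable {X : Type*} [NormedAddCommGroup X] {A K : Set X} {h x : X} {T : X → X}

theorem isFixedPt_of_tendsto_iterate_of_continuousWithinAt {y : X} (hT : ContinuousWithinAt T A y)
    (hTA : MapsTo T A A) (hx : x ∈ A) (hy : Tendsto (fun n => T^[n] x) atTop (𝓝 y)) : T y = y := by
  refine tendsto_nhds_unique ((tendsto_add_atTop_iff_nat 1).1 ?_) hy
  simp only [Function.iterate_succ' T]
  exact hT.tendsto.comp (tendsto_nhdsWithin_iff.2 ⟨hy, .of_forall fun n => hTA.iterate n hx⟩)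

/-- When no finite σ-net exists, indices can be chosen greedily. Separation makes `φ` injective,
hence divergent, though not necessarily monotone. -/
theorem exists_separated_subseq_of_not_totallyBounded {x : ℕ → X}
    (hx : ¬ TotallyBounded (range x)) :
    ∃ σ > 0, ∃ φ : ℕ → ℕ, Tendsto φ atTop atTop ∧ ∀ n m, n ≠ m → σ ≤ ‖x (φ n) - x (φ m)‖ := by
  rw [Metric.totallyBounded_iff] at hx
  push Not at hx
  obtain ⟨σ, hσ, hsep⟩ := hx
  have : Std.Symm fun i j => σ ≤ ‖x i - x j‖ := ⟨fun i j hij => by rwa [norm_sub_rev]⟩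
  obtain ⟨φ, -, hφ⟩ := exists_seq_of_forall_finset_exists' (fun _ : ℕ => True)
    (fun i j => σ ≤ ‖x i - x j‖) fun s _ => by
      obtain ⟨_, ⟨j, rfl⟩, hj⟩ := not_subset.1 (hsep (x '' s) (s.finite_toSet.image x))
      refine ⟨j, trivial, fun i hi => ?_⟩
      simp only [mem_iUnion, not_exists, Metric.mem_ball, not_lt] at hj
      rw [← dist_eq_norm, dist_comm]
      exact hj _ (mem_image_of_mem x hi)
  refine ⟨σ, hσ, φ, Function.Injective.nat_tendsto_atTop fun n m hnm => ?_,
    fun n m hnm => hφ hnm⟩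
  by_contra hne
  have h0 : σ ≤ ‖x (φ n) - x (φ m)‖ := hφ hne
  rw [hnm, sub_self, norm_zero] at h0
  linarith

/-- The points `y` of `A` with `limsup ‖T^[n] x + h - y‖ ≤ c`. -/
def asympSublevel (A : Set X) (h : X) (T : X → X) (x : X) (c : ℝ) : Set X :=
  {y ∈ A | ∀ η > 0, ∀ᶠ n in atTop, ‖T^[n] x + h - y‖ ≤ c + η}

theorem isClosed_asympSublevel (hA : IsClosed A) (c : ℝ) :
    IsClosed (asympSublevel A h T x c) := by
  refine isClosed_of_closure_subset fun y hy => ⟨?_, fun η hη => ?_⟩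
  · exact hA.closure_subset (closure_mono (fun _ hz => hz.1) hy)
  · obtain ⟨z, hz, hyz⟩ := Metric.mem_closure_iff.1 hy (η / 2) (by positivity)
    filter_upwards [hz.2 (η / 2) (by positivity)] with n hn
    rw [dist_comm, dist_eq_norm] at hyz
    have : ‖T^[n] x + h - y‖ ≤ ‖T^[n] x + h - z‖ + ‖z - y‖ :=
      norm_sub_le_norm_sub_add_norm_sub _ _ _
    linarith

theorem asympSublevel_add_iterate {ε c : ℝ} {m : ℕ} {y : X} (hTA : MapsTo T A A) (hx : x ∈ A)
    (hm : ∀ x ∈ A, ∀ y ∈ A, ‖T^[m] x + h - T^[m] y‖ ≤ ‖x + h - y‖ + ε)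
    (hy : y ∈ asympSublevel A h T x c) : T^[m] y ∈ asympSublevel A h T x (c + ε) := by
  refine ⟨hTA.iterate m hy.1, fun η hη => ?_⟩
  obtain ⟨N, hN⟩ := eventually_atTop.1 (hy.2 η hη)
  filter_upwards [eventually_ge_atTop (N + m)] with n hn
  obtain ⟨k, rfl⟩ := Nat.exists_eq_add_of_le' (le_of_add_le_right hn)
  have h1 := hN k (by omega)
  have h2 := hm _ (hTA.iterate k hx) y hy.1
  rw [← Function.iterate_add_apply, add_comm m k] at h2
  linarith

variable [NormedSpace ℝ X]

/-- `K` contains all weak subsequential limits of the `T`-orbits of its points. -/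
def ContainsWeakOrbitLimits (T : X → X) (K : Set X) : Prop :=
  ∀ x ∈ K, ∀ φ : ℕ → ℕ, Tendsto φ atTop atTop → ∀ z,
    WeaklyConvergesTo (fun n => T^[φ n] x) z → z ∈ K

theorem convex_asympSublevel (hA : Convex ℝ A) (c : ℝ) : Convex ℝ (asympSublevel A h T x c) := by
  rintro y ⟨hyA, hy⟩ z ⟨hzA, hz⟩ a b ha hb hab
  refine ⟨hA hyA hzA ha hb hab, fun η hη => ?_⟩
  filter_upwards [hy η hη, hz η hη] with n hn hn'
  rw [← mem_closedBall_iff_norm'] at hn hn' ⊢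
  exact convex_closedBall _ _ hn hn' ha hb hab

/-- A single application of `T` may leave the sublevel set, but late iterates enter every larger
one. These are weakly closed, so weak limits lie in all of them, hence in the original. -/
theorem containsWeakOrbitLimits_asympSublevel (hAcl : IsClosed A) (hAconv : Convex ℝ A)
    (hTA : MapsTo T A A)
    (hT : ∀ ε > 0, ∀ᶠ n in atTop, ∀ x ∈ A, ∀ y ∈ A,
      ‖T^[n] x + h - T^[n] y‖ ≤ ‖x + h - y‖ + ε)
    (hx : x ∈ A) (c : ℝ) : ContainsWeakOrbitLimits T (asympSublevel A h T x c) := by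
  intro y hy φ hφ z hz
  refine ⟨hz.mem_of_eventually hAcl hAconv (.of_forall fun n => hTA.iterate _ hy.1),
    fun η hη => ?_⟩
  have hmem : z ∈ asympSublevel A h T x (c + η / 2) :=
    hz.mem_of_eventually (isClosed_asympSublevel hAcl _) (convex_asympSublevel hAconv _)
      ((hφ.eventually (hT (η / 2) (by positivity))).mono fun n hn =>
        asympSublevel_add_iterate hTA hx hn hy)
  filter_upwards [hmem.2 (η / 2) (by positivity)] with n hn
  linarith

/-- In a reflexive space there is a minimal nonempty closed convex subset of `A` that contains the
weak subsequential limits of its orbits. -/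
theorem exists_minimal_containsWeakOrbitLimits (hX : IsReflexiveSpace X) (hA : A.Nonempty)
    (hAbdd : Bornology.IsBounded A) (hAcl : IsClosed A) (hAconv : Convex ℝ A)
    (hTA : MapsTo T A A) :
    ∃ K, Minimal (fun K => K ⊆ A ∧ K.Nonempty ∧ IsClosed K ∧ Convex ℝ K ∧
      ContainsWeakOrbitLimits T K) K := by
  have hchains : ∀ c ⊆ {K : Set X | K ⊆ A ∧ K.Nonempty ∧ IsClosed K ∧ Convex ℝ K ∧
      ContainsWeakOrbitLimits T K}, IsChain (· ⊆ ·) c → c.Nonempty →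
      ∃ lb ∈ {K : Set X | K ⊆ A ∧ K.Nonempty ∧ IsClosed K ∧ Convex ℝ K ∧
        ContainsWeakOrbitLimits T K}, ∀ s ∈ c, lb ⊆ s := by
    intro c hc hchain hne
    refine ⟨⋂₀ c, ⟨?_, ?_, isClosed_sInter fun s hs => (hc hs).2.2.1,
      convex_sInter fun s hs => (hc hs).2.2.2.1, fun y hy φ hφ z hz s hs =>
        (hc hs).2.2.2.2 y (hy s hs) φ hφ z hz⟩, fun s hs => sInter_subset_of_mem hs⟩
    · obtain ⟨s, hs⟩ := hne
      exact (sInter_subset_of_mem hs).trans (hc hs).1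
    · have : Nonempty c := hne.to_subtype
      obtain ⟨w, hw⟩ := IsCompact.nonempty_iInter_of_directed_nonempty_isCompact_isClosed
        (fun s : c => toWeakSpace ℝ X '' s)
        (fun s t => (hchain.total s.2 t.2).elim
          (fun hst => ⟨s, Subset.rfl, image_mono hst⟩) fun hts => ⟨t, image_mono hts, Subset.rfl⟩)
        (fun s => (hc s.2).2.1.image _)
        (fun s => hX.isCompact_toWeakSpace_image (hc s.2).2.2.1 (hc s.2).2.2.2.1
          (hAbdd.subset (hc s.2).1))
        (fun s => isClosed_toWeakSpace_image (hc s.2).2.2.1 (hc s.2).2.2.2.1)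
      refine ⟨(toWeakSpace ℝ X).symm w, fun s hs => ?_⟩
      obtain ⟨z, hz, rfl⟩ := mem_iInter.1 hw ⟨s, hs⟩
      simpa using hz
  obtain ⟨K, -, hK⟩ := zorn_superset_nonempty _ hchains A
    ⟨Subset.rfl, hA, hAcl, hAconv, fun y hy φ _ z hz =>
      hz.mem_of_eventually hAcl hAconv (.of_forall fun n => hTA.iterate _ hy)⟩
  exact ⟨K, hK⟩

/-- The two vectors of equal norm add up to `2h`. -/
theorem norm_le_norm_add_sub {y : X} (hsymm : ‖x + h - y‖ = ‖y + h - x‖) :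
    ‖h‖ ≤ ‖x + h - y‖ := by
  have h1 := norm_add_le (x + h - y) (y + h - x)
  have h2 : x + h - y + (y + h - x) = (2 : ℝ) • h := by rw [two_smul]; abel
  rw [h2, norm_smul, Real.norm_two] at h1
  linarith

/-- On a minimal set, `y ↦ limsup ‖T^[n] x + h - y‖` is constant. -/
theorem exists_asympSublevel_eq (hAbdd : Bornology.IsBounded A) (hAcl : IsClosed A)
    (hAconv : Convex ℝ A) (hsymm : ∀ x ∈ A, ∀ y ∈ A, ‖x + h - y‖ = ‖y + h - x‖)
    (hTA : MapsTo T A A)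
    (hT : ∀ ε > 0, ∀ᶠ n in atTop, ∀ x ∈ A, ∀ y ∈ A,
      ‖T^[n] x + h - T^[n] y‖ ≤ ‖x + h - y‖ + ε)
    (hK : Minimal (fun K => K ⊆ A ∧ K.Nonempty ∧ IsClosed K ∧ Convex ℝ K ∧
      ContainsWeakOrbitLimits T K) K) (hx : x ∈ A) :
    ∃ r, ‖h‖ ≤ r ∧ K ⊆ asympSublevel A h T x r ∧
      ∀ c < r, ∀ y ∈ K, y ∉ asympSublevel A h T x c := by
  obtain ⟨⟨hKA, ⟨y₀, hy₀⟩, hKcl, hKconv, hKlim⟩, hmin⟩ := hK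
  -- A nonempty intersection with a sublevel set competes with `K`, so by minimality it is all of
  -- `K`.
  have hall : ∀ c, (K ∩ asympSublevel A h T x c).Nonempty → K ⊆ asympSublevel A h T x c :=
    fun c hc => (hmin ⟨inter_subset_left.trans hKA, hc,
      hKcl.inter (isClosed_asympSublevel hAcl c), hKconv.inter (convex_asympSublevel hAconv c),
      fun y hy φ hφ z hz => ⟨hKlim y hy.1 φ hφ z hz,
        containsWeakOrbitLimits_asympSublevel hAcl hAconv hTA hT hx c y hy.2 φ hφ z hz⟩⟩
      inter_subset_left).trans inter_subset_right
  set R := {c | (K ∩ asympSublevel A h T x c).Nonempty}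
  have hlow : ∀ c ∈ R, ‖h‖ ≤ c := by
    rintro c ⟨y, -, hyA, hy⟩
    refine le_of_forall_pos_le_add fun η hη => ?_
    obtain ⟨n, hn⟩ := (hy η hη).exists
    exact (norm_le_norm_add_sub (hsymm _ (hTA.iterate n hx) _ hyA)).trans hn
  have hRne : R.Nonempty := by
    obtain ⟨M, hM⟩ := Metric.isBounded_iff.1 hAbdd
    refine ⟨M + ‖h‖, y₀, hy₀, hKA hy₀, fun η hη => .of_forall fun n => ?_⟩
    have h1 := hM (hTA.iterate n hx) (hKA hy₀)
    rw [dist_eq_norm] at h1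
    have h2 := norm_add_le (T^[n] x - y₀) h
    rw [sub_add_eq_add_sub] at h2
    linarith
  refine ⟨sInf R, le_csInf hRne hlow, fun y hy => ⟨hKA hy, fun η hη => ?_⟩, fun c hc y hy hyc =>
    notMem_of_lt_csInf hc ⟨_, hlow⟩ ⟨y, hy, hyc⟩⟩
  obtain ⟨c, hcR, hc⟩ := exists_lt_of_csInf_lt hRne (lt_add_of_pos_right (sInf R) (half_pos hη))
  filter_upwards [(hall c hcR hy).2 (η / 2) (half_pos hη)] with n hn
  linarith

theorem totallyBounded_range_iterate (hX : IsNUC X) (hAbdd : Bornology.IsBounded A)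
    (hAcl : IsClosed A) (hAconv : Convex ℝ A)
    (hsymm : ∀ x ∈ A, ∀ y ∈ A, ‖x + h - y‖ = ‖y + h - x‖) (hTA : MapsTo T A A)
    (hT : ∀ ε > 0, ∀ᶠ n in atTop, ∀ x ∈ A, ∀ y ∈ A,
      ‖T^[n] x + h - T^[n] y‖ ≤ ‖x + h - y‖ + ε)
    (hKlim : ContainsWeakOrbitLimits T K) (hx : x ∈ K) {r : ℝ} (hr : 0 < r)
    (hxr : x ∈ asympSublevel A h T x r) (hlow : ∀ c < r, ∀ y ∈ K, y ∉ asympSublevel A h T x c) :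
    TotallyBounded (range fun n => T^[n] x) := by
  by_contra htb
  have hxA : x ∈ A := hxr.1
  obtain ⟨σ, hσ, φ, hφ, hsep⟩ := exists_separated_subseq_of_not_totallyBounded htb
  obtain ⟨z, hzA, ψ, hψ, hz⟩ := hX.1.exists_subseq_weaklyConvergesTo hAcl hAconv hAbdd
    (x := fun n => T^[φ n] x) fun n => hTA.iterate _ hxA
  have hφψ : Tendsto (fun n => φ (ψ n)) atTop atTop := hφ.comp hψ.tendsto_atTop
  obtain ⟨δ, hδ, hukk⟩ := hX.2.exists_norm_le_mul hσ (by positivity : 0 < r + 1)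
  -- The weak limit `z` lies in `K`, so asymptotic distance at most `r * (1 - δ)` contradicts
  -- `hlow`.
  refine hlow (r * (1 - δ)) (by nlinarith) z (hKlim x hx _ hφψ z hz) ⟨hzA, fun η hη => ?_⟩
  obtain ⟨η', hη', hη1, hηη⟩ : ∃ η' > 0, η' ≤ 1 ∧ η' ≤ η :=
    ⟨min η 1, by positivity, min_le_right _ _, min_le_left _ _⟩
  filter_upwards [hT (η' / 2) (by positivity)] with m hm
  have hmem := asympSublevel_add_iterate hTA hxA hm hxr
  obtain ⟨N, hN⟩ := eventually_atTop.1 (hφψ.eventually (hmem.2 (η' / 2) (by positivity)))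
  -- For fixed large `m`, the shifted subsequence stays within `r + η'` of the centre `T^[m] x - h`.
  -- UKK pulls `z` closer to it, and symmetry of `d` turns this into a bound on `‖T^[m] x + h - z‖`.
  have key := hukk (r + η') (fun n => T^[φ (ψ (n + N))] x - (T^[m] x - h)) (z - (T^[m] x - h))
    (by positivity) (by linarith) (fun n => ?_)
    ((hz.comp (tendsto_add_atTop_nat N)).sub_const _) (fun n k hnk => ?_)
  · have h1 : z - (T^[m] x - h) = z + h - T^[m] x := by abel
    rw [hsymm _ (hTA.iterate m hxA) _ hzA, ← h1]
    nlinarith [mul_pos hη' hδ]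
  · have h1 := hN (n + N) (by omega)
    rw [← sub_add_eq_add_sub, sub_add] at h1
    linarith
  · rw [sub_sub_sub_cancel_right]
    exact hsep _ _ (hψ.injective.ne (by omega))

/-- The mean `u` of a finite net of the limit set of a precompact orbit lies strictly closer
to the orbit than the constant value of the asymptotic distance. -/
theorem not_totallyBounded_range_iterate [CompleteSpace X] (hKA : K ⊆ A) (hKconv : Convex ℝ K)
    (hKlim : ContainsWeakOrbitLimits T K) (hx : x ∈ K) {r : ℝ} (hr : ‖h‖ < r)
    (hKr : K ⊆ asympSublevel A h T x r)
    (hlow : ∀ c < r, ∀ y ∈ K, y ∉ asympSublevel A h T x c) :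
    ¬ TotallyBounded (range fun n => T^[n] x) := by
  intro htb
  have hcomp : IsCompact (closure (range fun n => T^[n] x)) :=
    htb.closure.isCompact_of_isClosed isClosed_closure
  have hsub : ∀ φ : ℕ → ℕ, ∃ z, ∃ ψ : ℕ → ℕ, StrictMono ψ ∧
      Tendsto (fun n => T^[φ (ψ n)] x) atTop (𝓝 z) := fun φ => by
    obtain ⟨z, -, ψ, hψ, hz⟩ := hcomp.tendsto_subseq
      (x := fun n => T^[φ n] x) fun n => subset_closure (mem_range_self _)
    exact ⟨z, ψ, hψ, hz⟩
  set L := {z | ∃ φ : ℕ → ℕ, Tendsto φ atTop atTop ∧ Tendsto (fun n => T^[φ n] x) atTop (𝓝 z)}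
  have hLK : L ⊆ K := fun z ⟨φ, hφ, hz⟩ => hKlim x hx φ hφ z (weaklyConvergesTo_of_tendsto hz)
  have hLtb : TotallyBounded L := htb.closure.subset fun z ⟨φ, _, hz⟩ =>
    mem_closure_of_tendsto hz (.of_forall fun n => mem_range_self _)
  -- Radius `r - ‖h‖` makes any limit point `y₀` satisfy `‖y₀ + h - y‖ < r` for some `y` in the net.
  obtain ⟨t, htL, htfin, htcov⟩ :=
    Metric.finite_approx_of_totallyBounded hLtb (r - ‖h‖) (by linarith)
  lift t to Finset X using htfin
  have htne : t.Nonempty := by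
    obtain ⟨z, ψ, hψ, hz⟩ := hsub id
    obtain ⟨y, hy, -⟩ := mem_iUnion₂.1 (htcov ⟨ψ, hψ.tendsto_atTop, hz⟩)
    exact ⟨y, hy⟩
  have hcard : (0 : ℝ) < t.card := by exact_mod_cast htne.card_pos
  set w : ℝ := (t.card : ℝ)⁻¹
  have hw : 0 < w := by positivity
  have hw1 : ∑ _y ∈ t, w = 1 := by
    rw [Finset.sum_const, nsmul_eq_mul, mul_inv_cancel₀ hcard.ne']
  set u := ∑ y ∈ t, w • y
  have huK : u ∈ K := hKconv.sum_mem (fun _ _ => hw.le) hw1 fun y hy => hLK (htL hy)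
  -- As `u ∈ K`, its asymptotic distance is at least `r`; precompactness realises this at an orbit
  -- limit point.
  obtain ⟨y₀, hy₀L, hy₀⟩ : ∃ y₀ ∈ L, r ≤ ‖y₀ + h - u‖ := by
    have hfreq : ∀ i : ℕ, ∃ n ≥ i, r - 1 / ((i : ℝ) + 1) ≤ ‖T^[n] x + h - u‖ := fun i => by
      by_contra! hcon
      refine hlow (r - 1 / ((i : ℝ) + 1)) (sub_lt_self _ (by positivity)) u huK
        ⟨hKA huK, fun η hη => ?_⟩
      filter_upwards [eventually_ge_atTop i] with n hn
      linarith [hcon n hn]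
    choose φ hφ hφr using hfreq
    obtain ⟨z, ψ, hψ, hz⟩ := hsub φ
    refine ⟨z, ⟨fun n => φ (ψ n),
      (tendsto_atTop_mono hφ tendsto_id).comp hψ.tendsto_atTop, hz⟩, ?_⟩
    have hl : Tendsto (fun n => r - 1 / ((ψ n : ℝ) + 1)) atTop (𝓝 (r - 0)) :=
      tendsto_const_nhds.sub (tendsto_one_div_add_atTop_nhds_zero_nat.comp hψ.tendsto_atTop)
    rw [sub_zero] at hl
    exact le_of_tendsto_of_tendsto' hl ((hz.add_const h).sub_const u).norm fun n => hφr (ψ n)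
  have hle : ∀ y ∈ t, ‖y₀ + h - y‖ ≤ r := fun y hy => by
    obtain ⟨φ, hφ, hz⟩ := hy₀L
    refine le_of_forall_pos_le_add fun η hη => ?_
    exact le_of_tendsto ((hz.add_const h).sub_const y).norm
      (hφ.eventually ((hKr (hLK (htL hy))).2 η hη))
  obtain ⟨y₁, hy₁, hlt⟩ : ∃ y ∈ t, ‖y₀ + h - y‖ < r := by
    obtain ⟨y, hy, hyb⟩ := mem_iUnion₂.1 (htcov hy₀L)
    refine ⟨y, hy, ?_⟩
    rw [Metric.mem_ball, dist_eq_norm] at hyb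
    have := norm_add_le (y₀ - y) h
    rw [sub_add_eq_add_sub] at this
    linarith
  have hsum : y₀ + h - u = ∑ y ∈ t, w • (y₀ + h - y) := by
    simp only [smul_sub, Finset.sum_sub_distrib]
    rw [← Finset.sum_smul, hw1, one_smul]
  have : ‖y₀ + h - u‖ < r := calc
    ‖y₀ + h - u‖ ≤ ∑ y ∈ t, w * ‖y₀ + h - y‖ := by
      rw [hsum]
      refine (norm_sum_le _ _).trans_eq (Finset.sum_congr rfl fun y _ => ?_)
      rw [norm_smul, Real.norm_of_nonneg hw.le]
    _ < ∑ y ∈ t, w * r := Finset.sum_lt_sum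
      (fun y hy => mul_le_mul_of_nonneg_left (hle y hy) hw.le)
      ⟨y₁, hy₁, mul_lt_mul_of_pos_left hlt hw⟩
    _ = r := by rw [← Finset.sum_mul, hw1, one_mul]
  linarith

/-- A fixed point theorem in NUC spaces for maps that are asymptotically nonexpansive for
`(x, y) ↦ ‖x + h - y‖`. -/
theorem exists_fixedPoint_of_asymptotic [CompleteSpace X] (hX : IsNUC X) (hA : A.Nonempty)
    (hAbdd : Bornology.IsBounded A) (hAcl : IsClosed A) (hAconv : Convex ℝ A)
    (hsymm : ∀ x ∈ A, ∀ y ∈ A, ‖x + h - y‖ = ‖y + h - x‖)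
    (huc : ∀ ε > 0, ∃ δ > 0, ∀ x ∈ A, ∀ y ∈ A, ‖x + h - y‖ ≤ ‖h‖ + δ → ‖x - y‖ ≤ ε)
    (hTcont : ContinuousOn T A) (hTA : MapsTo T A A)
    (hT : ∀ ε > 0, ∀ᶠ n in atTop, ∀ x ∈ A, ∀ y ∈ A,
      ‖T^[n] x + h - T^[n] y‖ ≤ ‖x + h - y‖ + ε) :
    ∃ x ∈ A, T x = x := by
  obtain ⟨K, hK⟩ := exists_minimal_containsWeakOrbitLimits hX.1 hA hAbdd hAcl hAconv hTA
  obtain ⟨hKA, ⟨x, hx⟩, -, hKconv, hKlim⟩ := hK.prop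
  obtain ⟨r, hhr, hKr, hlow⟩ :=
    exists_asympSublevel_eq hAbdd hAcl hAconv hsymm hTA hT hK (hKA hx)
  obtain rfl : ‖h‖ = r := by
    refine hhr.eq_of_not_lt fun hlt => ?_
    exact not_totallyBounded_range_iterate hKA hKconv hKlim hx hlt hKr hlow
      (totallyBounded_range_iterate hX hAbdd hAcl hAconv hsymm hTA hT hKlim hx
        ((norm_nonneg h).trans_lt hlt) (hKr hx) hlow)
  have hlim : Tendsto (fun n => T^[n] x) atTop (𝓝 x) := by
    rw [Metric.tendsto_atTop']
    intro ε hε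
    obtain ⟨δ, hδ, hδε⟩ := huc (ε / 2) (by positivity)
    obtain ⟨N, hN⟩ := eventually_atTop.1 ((hKr hx).2 δ hδ)
    refine ⟨N, fun n hn => ?_⟩
    rw [dist_eq_norm]
    linarith [hδε _ (hTA.iterate n (hKA hx)) x (hKA hx) (hN n hn.le)]
  exact ⟨x, hKA hx,
    isFixedPt_of_tendsto_iterate_of_continuousWithinAt (hTcont x (hKA hx)) hTA (hKA hx) hlim⟩

end FixedPoint

end BestProximity

namespace BestProximity

/-! ### From the pair `(A, A + h)` to estimates on `A`. -/

section Pair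

variable {X : Type*} [NormedAddCommGroup X] [NormedSpace ℝ X] {A : Set X} {h : X}

theorem setDist_image_add_const (hA : A.Nonempty)
    (hsymm : ∀ x ∈ A, ∀ y ∈ A, ‖x + h - y‖ = ‖y + h - x‖) :
    setDist A ((fun a => a + h) '' A) = ‖h‖ := by
  obtain ⟨x, hx⟩ := hA
  refine le_antisymm (csInf_le ⟨0, ?_⟩ ⟨x, hx, x + h, mem_image_of_mem _ hx, by simp⟩)
    (le_csInf ⟨_, x, hx, x + h, mem_image_of_mem _ hx, rfl⟩ ?_)
  · rintro _ ⟨a, -, b, -, rfl⟩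
    exact norm_nonneg _
  · rintro _ ⟨a, ha, _, ⟨b, hb, rfl⟩, rfl⟩
    dsimp only
    rw [norm_sub_rev]
    exact norm_le_norm_add_sub (hsymm b hb a ha)

/-- The property UC in `ε`-`δ` form. -/
theorem HasPropertyUC.exists_norm_sub_le (hA : A.Nonempty)
    (hsymm : ∀ x ∈ A, ∀ y ∈ A, ‖x + h - y‖ = ‖y + h - x‖)
    (hUC : HasPropertyUC A ((fun a => a + h) '' A)) {ε : ℝ} (hε : 0 < ε) :
    ∃ δ > 0, ∀ x ∈ A, ∀ y ∈ A, ‖x + h - y‖ ≤ ‖h‖ + δ → ‖x - y‖ ≤ ε := by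
  by_contra! hcon
  choose x hx y hy hxy hlt using fun n : ℕ => hcon (1 / ((n : ℝ) + 1)) (by positivity)
  have hlim : Tendsto (fun n => ‖x n - (y n + h)‖) atTop (𝓝 ‖h‖) := by
    have h1 : Tendsto (fun n : ℕ => ‖h‖ + 1 / ((n : ℝ) + 1)) atTop (𝓝 (‖h‖ + 0)) :=
      tendsto_const_nhds.add tendsto_one_div_add_atTop_nhds_zero_nat
    rw [add_zero] at h1
    have h2 : ∀ n, ‖x n - (y n + h)‖ = ‖x n + h - y n‖ := fun n => by
      rw [norm_sub_rev, hsymm _ (hy n) _ (hx n)]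
    simp only [h2]
    exact tendsto_of_tendsto_of_tendsto_of_le_of_le tendsto_const_nhds h1
      (fun n => norm_le_norm_add_sub (hsymm _ (hx n) _ (hy n))) hxy
  have h0 := hUC x y (fun n => y n + h) hx hy (fun n => mem_image_of_mem _ (hy n))
    (by rwa [setDist_image_add_const hA hsymm])
    (by rw [setDist_image_add_const hA hsymm]; simp)
  exact hε.not_ge (ge_of_tendsto' h0 fun n => (hlt n).le)

/-- Along an asymptotically relatively nonexpansive map, the iterates on `A` are asymptotically
nonexpansive for `(x, y) ↦ ‖x + h - y‖`, uniformly on bounded sets. -/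
theorem IsAsympRelNonexpansive.eventually_norm_le {T : X → X} (hA : A.Nonempty)
    (hAbdd : Bornology.IsBounded A)
    (hsymm : ∀ x ∈ A, ∀ y ∈ A, ‖x + h - y‖ = ‖y + h - x‖)
    (hUC : HasPropertyUC A ((fun a => a + h) '' A))
    (hTA : MapsTo T A A) (hTB : MapsTo T ((fun a => a + h) '' A) ((fun a => a + h) '' A))
    (hT : IsAsympRelNonexpansive A ((fun a => a + h) '' A) T) {ε : ℝ} (hε : 0 < ε) :
    ∀ᶠ n in atTop, ∀ x ∈ A, ∀ y ∈ A, ‖T^[n] x + h - T^[n] y‖ ≤ ‖x + h - y‖ + ε := by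
  obtain ⟨k, hk1, hk, hTk⟩ := hT
  obtain ⟨M, hM⟩ := Metric.isBounded_iff.1 hAbdd
  obtain ⟨δ, hδ, hδε⟩ := hUC.exists_norm_sub_le hA hsymm (half_pos hε)
  have hM0 : 0 ≤ M := dist_nonneg.trans (hM hA.some_mem hA.some_mem)
  have hk0 : Tendsto (fun n => (k n - 1) * (M + ‖h‖)) atTop (𝓝 0) := by
    simpa using (hk.sub_const 1).mul_const (M + ‖h‖)
  filter_upwards [hk0.eventually_le_const hδ, hk0.eventually_le_const (half_pos hε)]
    with n hnδ hnε x hx y hy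
  -- Write `T^[n] (y + h) = a + h`. Since `y` and `y + h` are at distance `‖h‖`, their images nearly
  -- are, so UC puts `a` near `T^[n] y`; then `a` can be replaced by `T^[n] y`.
  obtain ⟨a, ha, hay⟩ := hTB.iterate n (mem_image_of_mem (fun a => a + h) hy)
  dsimp only at hay
  have hkh : (k n - 1) * ‖h‖ ≤ (k n - 1) * (M + ‖h‖) :=
    mul_le_mul_of_nonneg_left (by linarith) (by linarith [hk1 n])
  have hkx : (k n - 1) * ‖x + h - y‖ ≤ (k n - 1) * (M + ‖h‖) := by
    refine mul_le_mul_of_nonneg_left ?_ (by linarith [hk1 n])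
    have h1 := hM hx hy
    rw [dist_eq_norm] at h1
    have h2 := norm_add_le (x - y) h
    rw [sub_add_eq_add_sub] at h2
    linarith
  have hrev : ∀ u ∈ A, ∀ v ∈ A, ‖u - (v + h)‖ = ‖u + h - v‖ := fun u hu v hv => by
    rw [norm_sub_rev, hsymm v hv u hu]
  have hTx := hTk n x hx (y + h) (mem_image_of_mem _ hy)
  have hTy := hTk n y hy (y + h) (mem_image_of_mem _ hy)
  rw [← hay, hrev _ (hTA.iterate n hx) _ ha, hrev _ hx _ hy] at hTx
  rw [← hay, hrev _ (hTA.iterate n hy) _ ha, hrev _ hy _ hy, add_sub_cancel_left] at hTy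
  have hclose := hδε _ (hTA.iterate n hy) a ha (by linarith)
  rw [norm_sub_rev] at hclose
  have htri : ‖T^[n] x + h - T^[n] y‖ ≤ ‖T^[n] x + h - a‖ + ‖a - T^[n] y‖ :=
    norm_sub_le_norm_sub_add_norm_sub _ _ _
  linarith

/-- The orbit of the translate `x + h` of a fixed point `x` converges to `x + h`. -/
theorem IsAsympRelNonexpansive.tendsto_iterate_add {T : X → X} {x : X}
    (hsymm : ∀ x ∈ A, ∀ y ∈ A, ‖x + h - y‖ = ‖y + h - x‖)
    (hUC : HasPropertyUC A ((fun a => a + h) '' A))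
    (hTB : MapsTo T ((fun a => a + h) '' A) ((fun a => a + h) '' A))
    (hT : IsAsympRelNonexpansive A ((fun a => a + h) '' A) T) (hx : x ∈ A) (hTx : T x = x) :
    Tendsto (fun n => T^[n] (x + h)) atTop (𝓝 (x + h)) := by
  obtain ⟨k, hk1, hk, hTk⟩ := hT
  have hxB : x + h ∈ (fun a => a + h) '' A := mem_image_of_mem _ hx
  rw [Metric.tendsto_atTop']
  intro ε hε
  obtain ⟨δ, hδ, hδε⟩ := hUC.exists_norm_sub_le ⟨x, hx⟩ hsymm (half_pos hε)
  have hk0 : Tendsto (fun n => k n * ‖h‖) atTop (𝓝 ‖h‖) := by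
    simpa using hk.mul_const ‖h‖
  obtain ⟨N, hN⟩ := eventually_atTop.1
    (hk0.eventually_le_const (lt_add_of_pos_right ‖h‖ hδ))
  refine ⟨N, fun n hn => ?_⟩
  obtain ⟨a, ha, hax⟩ := hTB.iterate n hxB
  dsimp only at hax
  -- As `x` is fixed, this bounds the distance from `x` to the orbit of `x + h` by `k n * ‖h‖`,
  -- which tends to the minimal value `‖h‖`.
  have h1 := hTk n x hx (x + h) hxB
  rw [← hax, Function.iterate_fixed hTx, norm_sub_rev, norm_sub_rev x, add_sub_cancel_left] at h1
  rw [← hax, dist_eq_norm, add_sub_add_right_eq_sub]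
  linarith [hδε a ha x hx (h1.trans (hN n hn.le))]

end Pair

end BestProximity

theorem theorem3p6 {X : Type*} [NormedAddCommGroup X] [NormedSpace ℝ X] [CompleteSpace X]
    (hX : BestProximity.IsNUC X)
    (A B : Set X) (hA : A.Nonempty) (hB : B.Nonempty)
    (hAbdd : Bornology.IsBounded A) (hBbdd : Bornology.IsBounded B)
    (hAcl : IsClosed A) (hBcl : IsClosed B)
    (hAconv : Convex ℝ A) (hBconv : Convex ℝ B)
    (hpar : BestProximity.IsProximalParallelPair A B)
    (hrect : BestProximity.HasRectangleProperty A B)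
    (hUC : BestProximity.HasPropertyUC A B)
    (T : X → X) (hTcont : ContinuousOn T (A ∪ B))
    (hTA : MapsTo T A A) (hTB : MapsTo T B B)
    (hT : BestProximity.IsAsympRelNonexpansive A B T) :
    ∃ x ∈ A, ∃ y ∈ B, T x = x ∧ T y = y ∧ ‖x - y‖ = BestProximity.setDist A B := by

  obtain ⟨h, rfl, hsymm⟩ := hrect
  have hsub := subset_union_left (s := A) (t := (fun a => a + h) '' A)
  obtain ⟨x, hx, hTx⟩ := BestProximity.exists_fixedPoint_of_asymptotic hX hA hAbdd hAcl hAconv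
    hsymm (fun ε hε => hUC.exists_norm_sub_le hA hsymm hε) (hTcont.mono hsub) hTA
    fun ε hε => hT.eventually_norm_le hA hAbdd hsymm hUC hTA hTB hε
  have hxB : x + h ∈ (fun a => a + h) '' A := mem_image_of_mem _ hx
  refine ⟨x, hx, x + h, hxB, hTx, ?_, ?_⟩
  · exact BestProximity.isFixedPt_of_tendsto_iterate_of_continuousWithinAt
      ((hTcont.mono subset_union_right) _ hxB) hTB hxB
      (hT.tendsto_iterate_add hsymm hUC hTB hx hTx)
  · rw [BestProximity.setDist_image_add_const hA hsymm, norm_sub_rev, add_sub_cancel_left]
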